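/- Let $\mathcal G=(\mathcal V,\mathcal E)$ be a finite undirected simple graph whose vertices (buses) are split into $N_G\ge 1$ generator buses (listed first) and $N_L\ge 1$ load buses; $N=N_G+N_L$, $E=|\mathcal E|$. Let $C\in\mathbb R^{N\times E}$ be its oriented incidence matrix (for any orientation of the edges), $B=\mathrm{diag}(b_1,\dots,b_E)$ with all $b_e>0$, and $L=CBC^{\mathsf T}$. For a cost vector $f\in\mathbb R^{N_G}$, a vector of limits $\xi=(\overline s^g,\underline s^g,\overline p,\underline p)\in\mathbb R^{2N_G+2E}$ and a load vector $s^l\in\mathbb R^{N_L}$, the DC-OPF problem is the linear program in $(s^g,\theta)\in\mathbb R^{N_G}\times\mathbb R^{N}$ $$\min f^{\mathsf T}s^g\quad\text{s.t.}\quad \theta_1=0,\quad L\theta=\begin{bmatrix}s^g\\-s^l\end{bmatrix},\quad \underline s^g\le s^g\le\overline s^g,\quad \underline p\le BC^{\mathsf T}\theta\le\overline p .$$ An inequality constraint is binding if it holds with equality at the optimal solution. Put - $\Omega_\xi$: the set of $\xi$ with $\underline s^g\ge 0$ for which the constraints are feasible for some $s^l>0$ (all vector inequalities are componentwise); - $\Omega_{s^l}(\xi)$: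 the set of $s^l>0$ for which the constraints are feasible; - $\Omega_f$: the set of $f\ge 0$ such that, for all $\xi\in\Omega_\xi$ and $s^l\in\Omega_{s^l}(\xi)$, the problem has a unique optimal solution $(s^g,\theta)$, and at it there are KKT multipliers of which at least $N_G-1$ among those of the inequality constraints are nonzero; - $\mathcal{OPF}(s^l)$, for $f\in\Omega_f$, $\xi\in\Omega_\xi$, $s^l\in\Omega_{s^l}(\xi)$: the component $s^g$ of the optimal solution; - $\widetilde\Omega_{s^l}(\xi,f)$: the set of $s^l\in\Omega_{s^l}(\xi)$ for which exactly $N_G-1$ inequality constraints are binding. **Theorem.** Let $f\in\Omega_f$. Then there is a dense subset $\widetilde\Omega_\xi(f)$ of $\Omega_\xi$ such that for every $\xi\in\widetilde\Omega_\xi(f)$: 1. $\mathrm{clos}(\mathrm{int}(\Omega_{s^l}(\xi)))=\mathrm{clos}(\Omega_{s^l}(\xi))$; 2. $\widetilde\Omega_{s^l}(\xi,f)$ is dense in $\Omega_{s^l}(\xi)$; 3. for every $s^l\in\widetilde\Omega_{s^l}(\xi,f)$, there is a neighbourhood of $s^l$ in $\mathbb R^{N_L}$ contained in $\Omega_{s^l}(\xi)$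 on which the set of binding inequality constraints is constant, and $\mathcal{OPF}$ is differentiable at $s^l$. -/

import Mathlib

open Matrix Topology

noncomputable section

/-- An undirected (simple) graph on `nG` generator buses and `nL` load buses, its `nE` edges
being enumerated and given an (arbitrary) reference orientation `tail → head`, with a positive
susceptance on every edge. No bus is both a generator and a load. -/
structure PowerNetwork (nG nL nE : ℕ) where
  graph : SimpleGraph (Fin nG ⊕ Fin nL)
  branch : Fin nE ≃ graph.edgeSet
  tail : Fin nE → Fin nG ⊕ Fin nL
  head : Fin nE → Fin nG ⊕ Fin nL
  ends : ∀ e, s(tail e, head e) = (branch e : Sym2 (Fin nG ⊕ Fin nL))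
  susceptance : Fin nE → ℝ
  susceptance_pos : ∀ e, 0 < susceptance e

/-- The `2 nG + 2 nE` inequality constraints (equivalently: coordinates of the limit vector). -/
inductive Limit (nG nE : ℕ) : Type
  | genUpper (i : Fin nG) : Limit nG nE
  | genLower (i : Fin nG) : Limit nG nE
  | flowUpper (e : Fin nE) : Limit nG nE
  | flowLower (e : Fin nE) : Limit nG nE

instance Limit.instFinite (nG nE : ℕ) : Finite (Limit nG nE) :=
  Finite.of_surjective
    (fun s : (Fin nG ⊕ Fin nG) ⊕ (Fin nE ⊕ Fin nE) =>
      Sum.elim (Sum.elim Limit.genUpper Limit.genLower)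
        (Sum.elim Limit.flowUpper Limit.flowLower) s)
    (by
      rintro (i | i | e | e)
      · exact ⟨Sum.inl (Sum.inl i), rfl⟩
      · exact ⟨Sum.inl (Sum.inr i), rfl⟩
      · exact ⟨Sum.inr (Sum.inl e), rfl⟩
      · exact ⟨Sum.inr (Sum.inr e), rfl⟩)

namespace PowerNetwork

variable {nG nL nE : ℕ}

/-- Oriented incidence matrix `C`. -/
def incidence (N : PowerNetwork nG nL nE) : Matrix (Fin nG ⊕ Fin nL) (Fin nE) ℝ :=
  Matrix.of fun v e => (if v = N.tail e then 1 else 0) - (if v = N.head e then 1 else 0)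

/-- `B = diag(b₁, …, b_E)`. -/
def susceptanceMatrix (N : PowerNetwork nG nL nE) : Matrix (Fin nE) (Fin nE) ℝ :=
  Matrix.diagonal N.susceptance

/-- Weighted Laplacian `L = C B Cᵀ`. -/
def laplacian (N : PowerNetwork nG nL nE) : Matrix (Fin nG ⊕ Fin nL) (Fin nG ⊕ Fin nL) ℝ :=
  N.incidence * N.susceptanceMatrix * N.incidenceᵀ

/-- Branch flows `B Cᵀ θ`. -/
def flow (N : PowerNetwork nG nL nE) (θ : Fin nG ⊕ Fin nL → ℝ) : Fin nE → ℝ :=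
  (N.susceptanceMatrix * N.incidenceᵀ) *ᵥ θ

/-- Feasibility of a decision vector `x = (s^g, θ)` for the DC-OPF problem with limits `ξ` and
loads `sl`; the slack bus is the first bus, a generator. -/
structure Feasible [NeZero nG] (N : PowerNetwork nG nL nE) (ξ : Limit nG nE → ℝ)
    (sl : Fin nL → ℝ) (x : (Fin nG → ℝ) × (Fin nG ⊕ Fin nL → ℝ)) : Prop where
  slack_bus : x.2 (Sum.inl 0) = 0
  balance : N.laplacian *ᵥ x.2 = Sum.elim x.1 (-sl)
  gen_lower : ∀ i, ξ (.genLower i) ≤ x.1 i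
  gen_upper : ∀ i, x.1 i ≤ ξ (.genUpper i)
  flow_lower : ∀ e, ξ (.flowLower e) ≤ N.flow x.2 e
  flow_upper : ∀ e, N.flow x.2 e ≤ ξ (.flowUpper e)

/-- `x = (s^g, θ)` is an optimal solution of the DC-OPF problem. -/
def IsOptimal [NeZero nG] (N : PowerNetwork nG nL nE) (f : Fin nG → ℝ) (ξ : Limit nG nE → ℝ)
    (sl : Fin nL → ℝ) (x : (Fin nG → ℝ) × (Fin nG ⊕ Fin nL → ℝ)) : Prop :=
  N.Feasible ξ sl x ∧ ∀ y, N.Feasible ξ sl y → f ⬝ᵥ x.1 ≤ f ⬝ᵥ y.1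

/-- The inequality constraint `c` holds with equality at `x`. -/
def IsTight (N : PowerNetwork nG nL nE) (ξ : Limit nG nE → ℝ)
    (x : (Fin nG → ℝ) × (Fin nG ⊕ Fin nL → ℝ)) : Limit nG nE → Prop
  | .genUpper i => x.1 i = ξ (.genUpper i)
  | .genLower i => x.1 i = ξ (.genLower i)
  | .flowUpper e => N.flow x.2 e = ξ (.flowUpper e)
  | .flowLower e => N.flow x.2 e = ξ (.flowLower e)

/-- The set of inequality constraints that are binding at the optimum (unambiguous whenever the
optimal solution is unique). -/
def bindingSet [NeZero nG] (N : PowerNetwork nG nL nE) (f : Fin nG → ℝ) (ξ : Limit nG nE → ℝ)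
    (sl : Fin nL → ℝ) : Set (Limit nG nE) :=
  {c | ∃ x, N.IsOptimal f ξ sl x ∧ N.IsTight ξ x c}

/-- The KKT conditions at `x`. The multipliers are `τ` (power balance), `τ₀` (slack bus), and
`ν` (inequalities): `ν ∘ genUpper = λ₊`, `ν ∘ genLower = λ₋`, `ν ∘ flowUpper = μ₊`,
`ν ∘ flowLower = μ₋`. -/
structure IsKKT [NeZero nG] (N : PowerNetwork nG nL nE) (f : Fin nG → ℝ) (ξ : Limit nG nE → ℝ)
    (sl : Fin nL → ℝ) (x : (Fin nG → ℝ) × (Fin nG ⊕ Fin nL → ℝ))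
    (τ : Fin nG ⊕ Fin nL → ℝ) (τ₀ : ℝ) (ν : Limit nG nE → ℝ) : Prop where
  feasible : N.Feasible ξ sl x
  stationary_angle :
    N.laplacianᵀ *ᵥ τ + τ₀ • Pi.single (Sum.inl 0) 1
      + (N.incidence * N.susceptanceMatrix) *ᵥ
          (fun e => ν (.flowUpper e) - ν (.flowLower e)) = 0
  stationary_gen : ∀ i, -f i = -τ (Sum.inl i) + ν (.genUpper i) - ν (.genLower i)
  nonneg : ∀ c, 0 ≤ ν c
  complementary : ∀ c, ν c = 0 ∨ N.IsTight ξ x c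

/-- `Ω_ξ`: the limit vectors with nonnegative lower generation limits that are feasible for some
positive load vector. -/
def limitSet [NeZero nG] (N : PowerNetwork nG nL nE) : Set (Limit nG nE → ℝ) :=
  {ξ | (∀ i, 0 ≤ ξ (.genLower i)) ∧
    ∃ sl : Fin nL → ℝ, (∀ j, 0 < sl j) ∧ ∃ x, N.Feasible ξ sl x}

/-- `Ω_{s^l}(ξ)`: the positive load vectors for which the problem is feasible. -/
def loadSet [NeZero nG] (N : PowerNetwork nG nL nE) (ξ : Limit nG nE → ℝ) :
    Set (Fin nL → ℝ) :=
  {sl | (∀ j, 0 < sl j) ∧ ∃ x, N.Feasible ξ sl x}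

/-- `Ω_f`: the nonnegative cost vectors for which, for all admissible limits and loads, the
problem has a unique solution `(s^g, θ)` and at least `nG - 1` nonzero dual variables (of the
inequality constraints) at the optimal point. -/
def costSet [NeZero nG] (N : PowerNetwork nG nL nE) : Set (Fin nG → ℝ) :=
  {f | (∀ i, 0 ≤ f i) ∧ ∀ ξ ∈ N.limitSet, ∀ sl ∈ N.loadSet ξ,
    (∃! x, N.IsOptimal f ξ sl x) ∧
    ∀ x, N.IsOptimal f ξ sl x →
      ∃ τ τ₀ ν, N.IsKKT f ξ sl x τ τ₀ ν ∧ nG - 1 ≤ {c | ν c ≠ 0}.ncard}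

/-- The operator `OPF` sending a load vector to the generation part of an optimal solution
(with the value `0` outside its domain, where there is no optimal solution). -/
def opf [NeZero nG] (N : PowerNetwork nG nL nE) (f : Fin nG → ℝ) (ξ : Limit nG nE → ℝ)
    (sl : Fin nL → ℝ) : Fin nG → ℝ :=
  open Classical in
  if h : ∃ x, N.IsOptimal f ξ sl x then (Classical.choose h).1 else 0

/-- The feasible positive loads with exactly `nG - 1` binding inequalities. -/
def regularLoadSet [NeZero nG] (N : PowerNetwork nG nL nE) (f : Fin nG → ℝ)
    (ξ : Limit nG nE → ℝ) : Set (Fin nL → ℝ) :=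
  {sl | sl ∈ N.loadSet ξ ∧ (N.bindingSet f ξ sl).ncard = nG - 1}

end PowerNetwork

end

open Matrix Topology Filter

/-! Once the slack angle is fixed, uniqueness of the optimum makes the angles determined by the
injections, so the problem lives on a space of `nG + nL` angles. The slack angle, the loads and the
quantities bounded by a set `T` of limits are `1 + nL + T.ncard` linear functions of the angles. If
`nG ≤ T.ncard`, they satisfy a nontrivial linear relation (`exists_relation`), so the limits in `T`
can all bind only when `(sl, ξ)` lies on a hyperplane. There are finitely many `T`. Relations among
limits alone are avoided by a generic `ξ`, the others by a generic `sl`, and the costs in `costSet`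
force at least `nG - 1` binding limits, so generically exactly `nG - 1` bind. In that case the
linear system is square and, by uniqueness, injective (`systemMap_injective`). Its solution is
affine in the loads and keeps the same KKT multipliers, hence stays optimal nearby
(`regular_load_stable`). Convexity of the limit and load sets, together with nonempty interiors,
lets genericity be tested on interiors. -/

namespace PowerNetwork

variable {nG nL nE : ℕ}

/-! ### Constraints in terms of the angles, and sufficiency of the KKT conditions. -/

/-- The quantity, as a linear function of the bus angles, that a limit bounds. -/
def limitQuantity (N : PowerNetwork nG nL nE) :
    Limit nG nE → (Fin nG ⊕ Fin nL → ℝ) →ₗ[ℝ] ℝ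
  | .genUpper i => LinearMap.proj (Sum.inl i) ∘ₗ N.laplacian.mulVecLin
  | .genLower i => LinearMap.proj (Sum.inl i) ∘ₗ N.laplacian.mulVecLin
  | .flowUpper e => LinearMap.proj e ∘ₗ (N.susceptanceMatrix * N.incidenceᵀ).mulVecLin
  | .flowLower e => LinearMap.proj e ∘ₗ (N.susceptanceMatrix * N.incidenceᵀ).mulVecLin

/-- The loads served by given bus angles. -/
def served (N : PowerNetwork nG nL nE) : (Fin nG ⊕ Fin nL → ℝ) →ₗ[ℝ] (Fin nL → ℝ) :=
  -(LinearMap.funLeft ℝ ℝ Sum.inr ∘ₗ N.laplacian.mulVecLin)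

/-- The generation produced at given bus angles. -/
def generated (N : PowerNetwork nG nL nE) : (Fin nG ⊕ Fin nL → ℝ) →ₗ[ℝ] (Fin nG → ℝ) :=
  LinearMap.funLeft ℝ ℝ Sum.inl ∘ₗ N.laplacian.mulVecLin

/-- The sign of a limit: `1` for upper limits and `-1` for lower limits. -/
def limitSign : Limit nG nE → ℝ
  | .genUpper _ => 1
  | .genLower _ => -1
  | .flowUpper _ => 1
  | .flowLower _ => -1

theorem limitSign_ne_zero (c : Limit nG nE) : limitSign c ≠ 0 := by
  cases c <;> simp [limitSign]

/-- Eliminates the generation and merges the four families of inequalities into one signed family.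
-/
theorem feasible_iff [NeZero nG] (N : PowerNetwork nG nL nE) (ξ : Limit nG nE → ℝ)
    (sl : Fin nL → ℝ) (x : (Fin nG → ℝ) × (Fin nG ⊕ Fin nL → ℝ)) :
    N.Feasible ξ sl x ↔ x.1 = N.generated x.2 ∧ x.2 (Sum.inl 0) = 0 ∧ N.served x.2 = sl ∧
      ∀ c, 0 ≤ limitSign c * (ξ c - N.limitQuantity c x.2) := by
  constructor
  · intro h
    have hgen : ∀ i, (N.laplacian *ᵥ x.2) (Sum.inl i) = x.1 i := fun i => by
      rw [h.balance]; rfl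
    refine ⟨funext fun i => (hgen i).symm, h.slack_bus, funext fun j => ?_, ?_⟩
    · change -((N.laplacian *ᵥ x.2) (Sum.inr j)) = _
      rw [h.balance]; simp
    · rintro (i | i | e | e)
      · have := h.gen_upper i
        simp only [limitSign, limitQuantity, LinearMap.comp_apply, mulVecLin_apply,
          LinearMap.proj_apply, hgen]
        linarith
      · have := h.gen_lower i
        simp only [limitSign, limitQuantity, LinearMap.comp_apply, mulVecLin_apply,
          LinearMap.proj_apply, hgen]
        linarith
      · have : 0 ≤ 1 * (ξ (.flowUpper e) - N.flow x.2 e) := by linarith [h.flow_upper e]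
        exact this
      · have : 0 ≤ -1 * (ξ (.flowLower e) - N.flow x.2 e) := by linarith [h.flow_lower e]
        exact this
  · rintro ⟨h1, h2, h3, h4⟩
    have hgen : ∀ i, x.1 i = (N.laplacian *ᵥ x.2) (Sum.inl i) := fun i => congrFun h1 i
    refine ⟨h2, ?_, fun i => ?_, fun i => ?_, fun e => ?_, fun e => ?_⟩
    · funext v
      rcases v with i | j
      · exact (hgen i).symm
      · have : -((N.laplacian *ᵥ x.2) (Sum.inr j)) = sl j := congrFun h3 j
        simp [← this]
    · have : 0 ≤ -1 * (ξ (.genLower i) - (N.laplacian *ᵥ x.2) (Sum.inl i)) := h4 (.genLower i)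
      rw [hgen]; linarith
    · have : 0 ≤ 1 * (ξ (.genUpper i) - (N.laplacian *ᵥ x.2) (Sum.inl i)) := h4 (.genUpper i)
      rw [hgen]; linarith
    · have : 0 ≤ -1 * (ξ (.flowLower e) - N.flow x.2 e) := h4 (.flowLower e)
      linarith
    · have : 0 ≤ 1 * (ξ (.flowUpper e) - N.flow x.2 e) := h4 (.flowUpper e)
      linarith

theorem isTight_iff (N : PowerNetwork nG nL nE) (ξ : Limit nG nE → ℝ)
    {x : (Fin nG → ℝ) × (Fin nG ⊕ Fin nL → ℝ)} (hx : x.1 = N.generated x.2)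
    (c : Limit nG nE) : N.IsTight ξ x c ↔ N.limitQuantity c x.2 = ξ c := by
  rcases c with i | i | e | e
  · simp only [IsTight, hx]; rfl
  · simp only [IsTight, hx]; rfl
  · rfl
  · rfl

/-- Weak duality: stationarity is paired with the difference of two feasible points, and
complementary slackness gives every inequality term a sign. -/
theorem IsKKT.isOptimal [NeZero nG] {N : PowerNetwork nG nL nE} {f : Fin nG → ℝ}
    {ξ : Limit nG nE → ℝ} {sl : Fin nL → ℝ} {x : (Fin nG → ℝ) × (Fin nG ⊕ Fin nL → ℝ)}
    {τ : Fin nG ⊕ Fin nL → ℝ} {τ₀ : ℝ} {ν : Limit nG nE → ℝ}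
    (h : N.IsKKT f ξ sl x τ τ₀ ν) : N.IsOptimal f ξ sl x := by
  refine ⟨h.feasible, fun y hy => ?_⟩
  have hx := h.feasible
  have hL : N.laplacian *ᵥ (y.2 - x.2) = Sum.elim (y.1 - x.1) 0 := by
    rw [mulVec_sub, hy.balance, hx.balance]
    funext v
    rcases v with i | j <;> simp
  have hflow : N.flow (y.2 - x.2) = N.flow y.2 - N.flow x.2 := mulVec_sub _ _ _
  have hT : (N.incidence * N.susceptanceMatrix)ᵀ = N.susceptanceMatrix * N.incidenceᵀ := by
    rw [transpose_mul, susceptanceMatrix, diagonal_transpose]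
  have hstat := congrArg (fun v => (y.2 - x.2) ⬝ᵥ v) h.stationary_angle
  simp only [dotProduct_add, dotProduct_zero, dotProduct_smul, dotProduct_single] at hstat
  have e1 : (y.2 - x.2) ⬝ᵥ N.laplacianᵀ *ᵥ τ = ∑ i, (y.1 i - x.1 i) * τ (Sum.inl i) := by
    rw [mulVec_transpose, dotProduct_comm, ← dotProduct_mulVec, hL, dotProduct_comm]
    simp [dotProduct]
  have e2 : (y.2 - x.2) ⬝ᵥ (N.incidence * N.susceptanceMatrix) *ᵥ
      (fun e => ν (.flowUpper e) - ν (.flowLower e))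
      = ∑ e, (N.flow y.2 e - N.flow x.2 e) * (ν (.flowUpper e) - ν (.flowLower e)) := by
    rw [dotProduct_mulVec, ← mulVec_transpose, hT]
    change N.flow (y.2 - x.2) ⬝ᵥ _ = _
    rw [hflow]
    simp [dotProduct]
  have e3 : (y.2 - x.2) (Sum.inl 0) = 0 := by
    simp [hx.slack_bus, hy.slack_bus]
  rw [e1, e2, e3] at hstat
  have hgen : ∑ i, (y.1 i - x.1 i) * (ν (.genUpper i) - ν (.genLower i)) ≤ 0 := by
    refine Finset.sum_nonpos fun i _ => ?_
    have a1 : (y.1 i - x.1 i) * ν (.genUpper i) ≤ 0 := by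
      rcases h.complementary (.genUpper i) with h0 | h0
      · simp [h0]
      · have h0' : x.1 i = ξ (.genUpper i) := h0
        exact mul_nonpos_of_nonpos_of_nonneg (by linarith [hy.gen_upper i]) (h.nonneg _)
    have a2 : 0 ≤ (y.1 i - x.1 i) * ν (.genLower i) := by
      rcases h.complementary (.genLower i) with h0 | h0
      · simp [h0]
      · have h0' : x.1 i = ξ (.genLower i) := h0
        exact mul_nonneg (by linarith [hy.gen_lower i]) (h.nonneg _)
    linarith
  have hfl : ∑ e, (N.flow y.2 e - N.flow x.2 e) * (ν (.flowUpper e) - ν (.flowLower e)) ≤ 0 := by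
    refine Finset.sum_nonpos fun i _ => ?_
    have a1 : (N.flow y.2 i - N.flow x.2 i) * ν (.flowUpper i) ≤ 0 := by
      rcases h.complementary (.flowUpper i) with h0 | h0
      · simp [h0]
      · have h0' : N.flow x.2 i = ξ (.flowUpper i) := h0
        exact mul_nonpos_of_nonpos_of_nonneg (by linarith [hy.flow_upper i]) (h.nonneg _)
    have a2 : 0 ≤ (N.flow y.2 i - N.flow x.2 i) * ν (.flowLower i) := by
      rcases h.complementary (.flowLower i) with h0 | h0
      · simp [h0]
      · have h0' : N.flow x.2 i = ξ (.flowLower i) := h0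
        exact mul_nonneg (by linarith [hy.flow_lower i]) (h.nonneg _)
    linarith
  have hobj : f ⬝ᵥ y.1 - f ⬝ᵥ x.1 = ∑ i, (y.1 i - x.1 i) * τ (Sum.inl i)
      - ∑ i, (y.1 i - x.1 i) * (ν (.genUpper i) - ν (.genLower i)) := by
    rw [← dotProduct_sub, ← Finset.sum_sub_distrib, dotProduct]
    refine Finset.sum_congr rfl fun i _ => ?_
    have : f i = τ (Sum.inl i) - ν (.genUpper i) + ν (.genLower i) := by
      linarith [h.stationary_gen i]
    rw [this, Pi.sub_apply]; ring
  simp at hstat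
  linarith

/-- Limits and loads enter the KKT conditions only through feasibility and tightness, so the
multipliers can be reused after a perturbation. -/
theorem IsKKT.of_feasible [NeZero nG] {N : PowerNetwork nG nL nE} {f : Fin nG → ℝ}
    {ξ : Limit nG nE → ℝ} {sl sl' : Fin nL → ℝ}
    {x x' : (Fin nG → ℝ) × (Fin nG ⊕ Fin nL → ℝ)}
    {τ : Fin nG ⊕ Fin nL → ℝ} {τ₀ : ℝ} {ν : Limit nG nE → ℝ}
    (h : N.IsKKT f ξ sl x τ τ₀ ν) (hx' : N.Feasible ξ sl' x')
    (ht : ∀ c, N.IsTight ξ x c → N.IsTight ξ x' c) : N.IsKKT f ξ sl' x' τ τ₀ ν :=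
  ⟨hx', h.stationary_angle, h.stationary_gen, h.nonneg,
    fun c => (h.complementary c).imp_right (ht c)⟩

/-! ### Angles and injections -/

theorem sum_laplacian_mulVec (N : PowerNetwork nG nL nE) (θ : Fin nG ⊕ Fin nL → ℝ) :
    ∑ v, (N.laplacian *ᵥ θ) v = 0 := by
  have h1 : (1 : Fin nG ⊕ Fin nL → ℝ) ᵥ* N.incidence = 0 := by
    funext e
    simp [vecMul, dotProduct, incidence]
  have : ∑ v, (N.laplacian *ᵥ θ) v = (1 : Fin nG ⊕ Fin nL → ℝ) ⬝ᵥ (N.laplacian *ᵥ θ) := by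
    simp [dotProduct]
  rw [this, laplacian, dotProduct_mulVec, ← vecMul_vecMul, ← vecMul_vecMul, h1]
  simp

/-- The energy `θ ⬝ᵥ L θ` is a sum of squares weighted by the positive susceptances. -/
theorem flow_eq_zero_of_laplacian_mulVec_eq_zero (N : PowerNetwork nG nL nE)
    {θ : Fin nG ⊕ Fin nL → ℝ} (h : N.laplacian *ᵥ θ = 0) : N.flow θ = 0 := by
  have hflow : ∀ e, N.flow θ e = N.susceptance e * (N.incidenceᵀ *ᵥ θ) e := fun e => by
    rw [flow, ← mulVec_mulVec, susceptanceMatrix, mulVec_diagonal]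
  have h0 : θ ⬝ᵥ (N.laplacian *ᵥ θ) = ∑ e, N.susceptance e * (N.incidenceᵀ *ᵥ θ) e ^ 2 := by
    have : N.laplacian *ᵥ θ = N.incidence *ᵥ N.flow θ := by
      rw [flow, laplacian, Matrix.mul_assoc, mulVec_mulVec]
    rw [this, dotProduct_mulVec, ← mulVec_transpose, dotProduct]
    exact Finset.sum_congr rfl fun e _ => by rw [hflow]; ring
  rw [h, dotProduct_zero, eq_comm, Finset.sum_eq_zero_iff_of_nonneg
    (fun e _ => mul_nonneg (N.susceptance_pos e).le (sq_nonneg _))] at h0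
  funext e
  have := h0 e (Finset.mem_univ e)
  have h2 : (N.incidenceᵀ *ᵥ θ) e = 0 := by
    simpa [(N.susceptance_pos e).ne'] using this
  simp [hflow, h2]

theorem limitQuantity_eq_zero (N : PowerNetwork nG nL nE)
    {θ : Fin nG ⊕ Fin nL → ℝ} (h : N.laplacian *ᵥ θ = 0) (c : Limit nG nE) :
    N.limitQuantity c θ = 0 := by
  have h' := N.flow_eq_zero_of_laplacian_mulVec_eq_zero h
  rcases c with i | i | e | e
  · exact congrFun h _
  · exact congrFun h _
  · exact congrFun h' _
  · exact congrFun h' _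

/-- No nonzero angle vector with zero slack angle has zero injections; for a power network this
amounts to connectedness. -/
def AnglesDetermined [NeZero nG] (N : PowerNetwork nG nL nE) : Prop :=
  ∀ θ : Fin nG ⊕ Fin nL → ℝ, θ (Sum.inl 0) = 0 → N.laplacian *ᵥ θ = 0 → θ = 0

/-- Adding a kernel vector with zero slack angle changes neither the cost nor any constraint, so it
would give a second optimum. -/
theorem anglesDetermined_of_existsUnique [NeZero nG] {N : PowerNetwork nG nL nE}
    {f : Fin nG → ℝ} {ξ : Limit nG nE → ℝ} {sl : Fin nL → ℝ}
    (h : ∃! x, N.IsOptimal f ξ sl x) : N.AnglesDetermined := by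
  intro θ h0 hθ
  obtain ⟨x, hx, huniq⟩ := h
  have hy : N.IsOptimal f ξ sl (x.1, x.2 + θ) := by
    refine ⟨?_, hx.2⟩
    have := (N.feasible_iff ξ sl x).1 hx.1
    rw [feasible_iff]
    refine ⟨?_, ?_, ?_, ?_⟩
    · simpa [generated, mulVec_add, hθ] using this.1
    · simpa [h0] using this.2.1
    · simpa [served, mulVec_add, hθ] using this.2.2.1
    · simpa [N.limitQuantity_eq_zero hθ] using this.2.2.2
  simpa using congrArg Prod.snd (huniq _ hy)

theorem AnglesDetermined.exists_angles [NeZero nG] {N : PowerNetwork nG nL nE}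
    (hN : N.AnglesDetermined) {y : Fin nG ⊕ Fin nL → ℝ} (hy : ∑ v, y v = 0) :
    ∃ θ : Fin nG ⊕ Fin nL → ℝ, θ (Sum.inl 0) = 0 ∧ N.laplacian *ᵥ θ = y := by
  -- A rank-one correction at the slack bus makes the Laplacian invertible. Since Laplacian outputs
  -- sum to zero, the coordinates of `Φ θ` sum to the slack angle.
  let Φ : (Fin nG ⊕ Fin nL → ℝ) →ₗ[ℝ] (Fin nG ⊕ Fin nL → ℝ) :=
    N.laplacian.mulVecLin +
      LinearMap.single ℝ (fun _ => ℝ) (Sum.inl 0) ∘ₗ LinearMap.proj (Sum.inl 0)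
  have hΦ : ∀ θ, Φ θ = N.laplacian *ᵥ θ + Pi.single (Sum.inl 0) (θ (Sum.inl 0)) :=
    fun θ => rfl
  have hsum : ∀ θ, ∑ v, Φ θ v = θ (Sum.inl 0) := fun θ => by
    simp only [hΦ, Pi.add_apply, Finset.sum_add_distrib, N.sum_laplacian_mulVec, zero_add]
    exact Fintype.sum_pi_single' _ _
  have hinj : Function.Injective Φ := by
    rw [← LinearMap.ker_eq_bot, LinearMap.ker_eq_bot']
    intro θ hθ
    have h0 : θ (Sum.inl 0) = 0 := by rw [← hsum θ, hθ]; simp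
    refine hN θ h0 ?_
    simpa [hΦ, h0] using hθ
  obtain ⟨θ, hθ⟩ := LinearMap.injective_iff_surjective.1 hinj y
  have h0 : θ (Sum.inl 0) = 0 := by rw [← hsum θ, hθ, hy]
  exact ⟨θ, h0, by simpa [hΦ, h0] using hθ⟩

/-- Slack angle and served loads, jointly. -/
def slackServed [NeZero nG] (N : PowerNetwork nG nL nE) :
    (Fin nG ⊕ Fin nL → ℝ) →ₗ[ℝ] ℝ × (Fin nL → ℝ) :=
  (LinearMap.proj (Sum.inl 0)).prod N.served

theorem AnglesDetermined.slackServed_surjective [NeZero nG] {N : PowerNetwork nG nL nE}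
    (hN : N.AnglesDetermined) : Function.Surjective N.slackServed := by
  rintro ⟨t, sl⟩
  obtain ⟨θ, h0, hθ⟩ := hN.exists_angles
    -- The slack generator supplies the whole load; a constant shift of the angles then sets the
    -- slack angle without changing injections.
    (y := Sum.elim (Pi.single 0 (∑ j, sl j)) (-sl)) (by simp)
  have hconst : N.laplacian *ᵥ (fun _ => t) = 0 := by
    have : N.incidenceᵀ *ᵥ (fun _ => t) = 0 := by
      funext e
      simp [mulVec, dotProduct, incidence, ← Finset.sum_mul]
    rw [laplacian, ← mulVec_mulVec, this, mulVec_zero]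
  refine ⟨θ + fun _ => t, Prod.ext ?_ ?_⟩
  · simp [slackServed, h0]
  · funext j
    simp [slackServed, served, hθ, hconst, mulVec_add, LinearMap.funLeft_apply]

/-! ### Convexity and interiors of the parameter sets -/

theorem Feasible.combo [NeZero nG] {N : PowerNetwork nG nL nE} {ξ ξ' : Limit nG nE → ℝ}
    {sl sl' : Fin nL → ℝ} {x x' : (Fin nG → ℝ) × (Fin nG ⊕ Fin nL → ℝ)}
    (h : N.Feasible ξ sl x) (h' : N.Feasible ξ' sl' x') {a b : ℝ} (ha : 0 ≤ a) (hb : 0 ≤ b) :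
    N.Feasible (a • ξ + b • ξ') (a • sl + b • sl') (a • x + b • x') := by
  rw [feasible_iff] at *
  obtain ⟨h1, h2, h3, h4⟩ := h
  obtain ⟨h1', h2', h3', h4'⟩ := h'
  refine ⟨?_, ?_, ?_, fun c => ?_⟩
  · simp [h1, h1']
  · simp [h2, h2']
  · simp [h3, h3']
  · have e := add_nonneg (mul_nonneg ha (h4 c)) (mul_nonneg hb (h4' c))
    simp only [Prod.snd_add, Prod.smul_snd, map_add, map_smul, Pi.add_apply, Pi.smul_apply,
      smul_eq_mul]
    linarith

theorem combo_pos {ι : Type*} {s t : ι → ℝ} (hs : ∀ j, 0 < s j) (ht : ∀ j, 0 < t j) {a b : ℝ}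
    (ha : 0 ≤ a) (hb : 0 ≤ b) (hab : a + b = 1) (j : ι) : 0 < (a • s + b • t) j :=
  (convex_Ioi (0 : ℝ)) (hs j) (ht j) ha hb hab

theorem convex_limitSet [NeZero nG] (N : PowerNetwork nG nL nE) : Convex ℝ N.limitSet := by
  rintro ξ ⟨h0, sl, hsl, x, hx⟩ ξ' ⟨h0', sl', hsl', x', hx'⟩ a b ha hb hab
  exact ⟨fun i => add_nonneg (mul_nonneg ha (h0 i)) (mul_nonneg hb (h0' i)),
    _, combo_pos hsl hsl' ha hb hab, _, hx.combo hx' ha hb⟩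

theorem convex_loadSet [NeZero nG] (N : PowerNetwork nG nL nE) (ξ : Limit nG nE → ℝ) :
    Convex ℝ (N.loadSet ξ) := by
  rintro sl ⟨hsl, x, hx⟩ sl' ⟨hsl', x', hx'⟩ a b ha hb hab
  refine ⟨combo_pos hsl hsl' ha hb hab, a • x + b • x', ?_⟩
  have := hx.combo hx' ha hb
  rwa [Convex.combo_self hab] at this

/-- Take angles at which each generator produces `1` and each load draws `nG / nL`. Limits at
distance `1 / 2` from the resulting quantities hold strictly, and strictness survives perturbing the
limits. -/
theorem AnglesDetermined.interior_limitSet_nonempty [NeZero nG] [NeZero nL]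
    {N : PowerNetwork nG nL nE} (hN : N.AnglesDetermined) : (interior N.limitSet).Nonempty := by
  have hG : (0 : ℝ) < nG := Nat.cast_pos.2 (NeZero.pos nG)
  have hL : (0 : ℝ) < nL := Nat.cast_pos.2 (NeZero.pos nL)
  obtain ⟨θ, h0, hθ⟩ := hN.exists_angles
    (y := Sum.elim (fun _ => 1) (-fun _ => (nG / nL : ℝ))) (by simp; field_simp; simp)
  have hg : N.generated θ = fun _ => 1 := by
    funext i; simp [generated, hθ, LinearMap.funLeft_apply]
  have hs : N.served θ = fun _ => (nG / nL : ℝ) := by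
    funext i; simp [served, hθ, LinearMap.funLeft_apply]
  let S : Set (Limit nG nE → ℝ) := {ξ | (∀ i, 0 < ξ (.genLower i)) ∧
    ∀ c, 0 < limitSign c * (ξ c - N.limitQuantity c θ)}
  have hS : IsOpen S := by
    refine isOpen_iff_eventually.2 fun ξ hξ => Filter.Eventually.and ?_ ?_
    · exact eventually_all.2 fun i =>
        ((continuous_apply _).tendsto ξ).eventually_const_lt (hξ.1 i)
    · exact eventually_all.2 fun c => ((continuous_const.mul
        ((continuous_apply c).sub continuous_const)).tendsto ξ).eventually_const_lt (hξ.2 c)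
  refine ⟨fun c => N.limitQuantity c θ + limitSign c / 2,
    interior_maximal (t := S) ?_ hS ⟨fun i => ?_, fun c => ?_⟩⟩
  · rintro ξ ⟨h1, h2⟩
    exact ⟨fun i => (h1 i).le, _, fun _ => div_pos hG hL, (N.generated θ, θ),
      (N.feasible_iff _ _ _).2 ⟨rfl, h0, hs, fun c => (h2 c).le⟩⟩
  · have : N.limitQuantity (.genLower i) θ = 1 := congrFun hg i
    simp only [this]
    norm_num [limitSign]
  · cases c <;> norm_num [limitSign]

theorem AnglesDetermined.interior_loadSet_nonempty [NeZero nG]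
    {N : PowerNetwork nG nL nE} (hN : N.AnglesDetermined) {ξ : Limit nG nE → ℝ}
    (hξ : ξ ∈ interior N.limitSet) : (interior (N.loadSet ξ)).Nonempty := by
  -- All limits are tightened by a small `t > 0`, which is still admissible; a point feasible for
  -- the tightened limits is strictly feasible for `ξ`.
  have hcont : ContinuousAt (fun t : ℝ => fun c => ξ c - t * limitSign c) 0 := by
    fun_prop
  have hev : ∀ᶠ t in 𝓝 (0 : ℝ), (fun c => ξ c - t * limitSign c) ∈ N.limitSet :=
    hcont.eventually_mem (by simpa using mem_interior_iff_mem_nhds.1 hξ)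
  obtain ⟨t, ht, ht0⟩ :=
    ((hev.filter_mono nhdsWithin_le_nhds).and (self_mem_nhdsWithin (s := Set.Ioi (0 : ℝ)))).exists
  obtain ⟨-, sl, hsl, x, hx⟩ := ht
  rw [feasible_iff] at hx
  obtain ⟨-, h0, hs, hc⟩ := hx
  have hstrict : ∀ c, 0 < limitSign c * (ξ c - N.limitQuantity c x.2) := fun c => by
    have h1 := hc c
    have h2 : 0 < limitSign c * limitSign c := mul_self_pos.2 (limitSign_ne_zero c)
    have h3 : 0 < t * (limitSign c * limitSign c) := mul_pos ht0 h2
    linarith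
  obtain ⟨R, hR⟩ := N.slackServed.exists_rightInverse_of_surjective
    (LinearMap.range_eq_top.2 hN.slackServed_surjective)
  -- A linear right inverse moves the angles continuously with the loads while keeping the slack
  -- angle zero.
  let θ : (Fin nL → ℝ) → (Fin nG ⊕ Fin nL → ℝ) := fun s => x.2 + R (0, s - sl)
  have hRc : Continuous R := R.continuous_of_finiteDimensional
  have hθ : Continuous θ := by fun_prop
  have hθ0 : θ sl = x.2 := by
    have : ((0 : ℝ), (0 : Fin nL → ℝ)) = 0 := rfl
    simp [θ, this]
  have hθs : ∀ s, N.slackServed (θ s) = (0, s) := fun s => by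
    have h1 : N.slackServed (R (0, s - sl)) = (0, s - sl) := LinearMap.congr_fun hR _
    have h2 : N.slackServed x.2 = (0, sl) := Prod.ext h0 hs
    simp [θ, h1, h2]
  refine ⟨sl, mem_interior_iff_mem_nhds.2 ?_⟩
  have hpos : ∀ᶠ s in 𝓝 sl, ∀ j, 0 < s j :=
    eventually_all.2 fun j => (continuous_apply j).continuousAt.eventually_const_lt (hsl j)
  have hlim : ∀ᶠ s in 𝓝 sl, ∀ c, 0 < limitSign c * (ξ c - N.limitQuantity c (θ s)) := by
    refine eventually_all.2 fun c => Tendsto.eventually_const_lt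
      (by rw [← hθ0] at hstrict; exact hstrict c) (Continuous.tendsto ?_ sl)
    have := (N.limitQuantity c).continuous_of_finiteDimensional
    fun_prop
  filter_upwards [hpos, hlim] with s h1 h2
  exact ⟨h1, (N.generated (θ s), θ s), (N.feasible_iff _ _ _).2
    ⟨rfl, congrArg Prod.fst (hθs s), congrArg Prod.snd (hθs s), fun c => (h2 c).le⟩⟩

/-! ### Generic limits and loads -/

theorem isOpen_dense_affine_ne_zero {E : Type*} [NormedAddCommGroup E] [NormedSpace ℝ E]
    [FiniteDimensional ℝ E] {u : E →ₗ[ℝ] ℝ} (hu : u ≠ 0) (r : ℝ) :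
    IsOpen {x | u x + r ≠ 0} ∧ Dense {x | u x + r ≠ 0} := by
  have huc : Continuous u := u.continuous_of_finiteDimensional
  refine ⟨isOpen_ne_fun (by fun_prop) continuous_const, fun x => ?_⟩
  by_cases hx : u x + r = 0
  · obtain ⟨v, hv⟩ : ∃ v, u v ≠ 0 := by
      by_contra! h
      exact hu (LinearMap.ext h)
    have ht : Tendsto (fun t : ℝ => x + t • v) (𝓝[≠] 0) (𝓝 x) := by
      have : ContinuousAt (fun t : ℝ => x + t • v) 0 := by fun_prop
      have h2 := this.tendsto.mono_left (nhdsWithin_le_nhds (s := {0}ᶜ))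
      simpa using h2
    refine mem_closure_of_tendsto ht ?_
    filter_upwards [self_mem_nhdsWithin] with t ht0
    have : u (x + t • v) + r = t * u v := by
      simp only [map_add, map_smul, smul_eq_mul]; linarith
    change u (x + t • v) + r ≠ 0
    rw [this]
    exact mul_ne_zero ht0 hv
  · exact subset_closure hx

theorem dense_iInter_of_finite {ι E : Type*} [Finite ι] [TopologicalSpace E]
    {s : ι → Set E} (h : ∀ i, IsOpen (s i) ∧ Dense (s i)) : Dense (⋂ i, s i) := by
  have hfin := Set.finite_range s
  rw [← Set.sInter_range]
  exact hfin.dense_sInter (by rintro _ ⟨i, rfl⟩; exact (h i).1)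
    (by rintro _ ⟨i, rfl⟩; exact (h i).2)

/-- Slack angle, served loads and the quantities bounded by the limits in `T`, jointly. -/
def systemMap [NeZero nG] (N : PowerNetwork nG nL nE) (T : Set (Limit nG nE)) :
    (Fin nG ⊕ Fin nL → ℝ) →ₗ[ℝ] (ℝ × (Fin nL → ℝ)) × (T → ℝ) :=
  N.slackServed.prod (LinearMap.pi fun c : T => N.limitQuantity c)

theorem finrank_systemMap_codomain (T : Set (Limit nG nE)) :
    Module.finrank ℝ ((ℝ × (Fin nL → ℝ)) × (T → ℝ)) = 1 + nL + T.ncard := by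
  have : Fintype T := Fintype.ofFinite T
  rw [Module.finrank_prod, Module.finrank_prod, Module.finrank_fintype_fun_eq_card,
    Module.finrank_fintype_fun_eq_card, Module.finrank_self, Fintype.card_fin,
    ← Nat.card_eq_fintype_card, Nat.card_coe_set_eq]

/-- Too many limits in force impose a nontrivial linear relation on loads and limits. -/
theorem AnglesDetermined.exists_relation [NeZero nG] {N : PowerNetwork nG nL nE}
    (hN : N.AnglesDetermined) {T : Set (Limit nG nE)} (hT : nG ≤ T.ncard) :
    ∃ (u : (Fin nL → ℝ) →ₗ[ℝ] ℝ) (w : (Limit nG nE → ℝ) →ₗ[ℝ] ℝ), (u = 0 → w ≠ 0) ∧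
      ∀ θ (ξ : Limit nG nE → ℝ), θ (Sum.inl 0) = 0 → (∀ c ∈ T, N.limitQuantity c θ = ξ c) →
        u (N.served θ) + w ξ = 0 := by
  -- The domain has dimension `nG + nL`, the codomain at least `nG + nL + 1`.
  have hlt : LinearMap.range (N.systemMap T) < ⊤ := by
    refine lt_top_iff_ne_top.2 fun h => ?_
    have h1 := LinearMap.finrank_range_le (N.systemMap T)
    rw [h, finrank_top, finrank_systemMap_codomain, Module.finrank_fintype_fun_eq_card,
      Fintype.card_sum, Fintype.card_fin, Fintype.card_fin] at h1
    omega
  obtain ⟨φ, hφ, hle⟩ := Submodule.exists_le_ker_of_lt_top _ hlt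
  have hφθ : ∀ θ, φ ((θ (Sum.inl 0), N.served θ), fun c : T => N.limitQuantity c θ) = 0 :=
    fun θ => hle ⟨θ, rfl⟩
  let restr : (Limit nG nE → ℝ) →ₗ[ℝ] (T → ℝ) := LinearMap.funLeft ℝ ℝ Subtype.val
  have hrestr : Function.Surjective restr :=
    LinearMap.funLeft_surjective_of_injective ℝ ℝ _ Subtype.val_injective
  refine ⟨φ ∘ₗ LinearMap.inl ℝ _ _ ∘ₗ LinearMap.inr ℝ _ _,
    φ ∘ₗ LinearMap.inr ℝ _ _ ∘ₗ restr, fun hu hw => hφ ?_, fun θ ξ h0 hξ => ?_⟩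
  -- If both parts vanished, `φ` would kill the limit coordinates, and then, by surjectivity of
  -- `slackServed`, the remaining ones too.
  · have hw' : ∀ η, φ (0, η) = 0 := fun η => by
      obtain ⟨ξ, rfl⟩ := hrestr η
      exact LinearMap.congr_fun hw ξ
    have key : ∀ p, φ (p, 0) = 0 := fun p => by
      obtain ⟨θ, rfl⟩ := hN.slackServed_surjective p
      have h1 := hφθ θ
      have h2 : ((θ (Sum.inl 0), N.served θ), fun c : T => N.limitQuantity c θ)
          = (N.slackServed θ, 0) + (0, fun c : T => N.limitQuantity c θ) := by
        simp [slackServed]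
      rwa [h2, map_add, hw', add_zero] at h1
    refine LinearMap.ext fun ⟨p, η⟩ => ?_
    have : (p, η) = (p, 0) + (0, η) := by simp
    rw [this, map_add, key, hw']; simp
  · have h1 := hφθ θ
    have h2 : (fun c : T => N.limitQuantity c θ) = restr ξ := funext fun c => hξ c c.2
    have h3 : ((θ (Sum.inl 0), N.served θ), fun c : T => N.limitQuantity c θ)
        = ((0, N.served θ), 0) + (0, restr ξ) := by
      simp [h0, h2]
    rw [h3, map_add] at h1
    exact h1

/-! ### The optimal power flow operator -/

theorem exists_kkt_of_mem_costSet [NeZero nG] {N : PowerNetwork nG nL nE} {f : Fin nG → ℝ}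
    (hf : f ∈ N.costSet) {ξ : Limit nG nE → ℝ} (hξ : ξ ∈ N.limitSet) {sl : Fin nL → ℝ}
    (hsl : sl ∈ N.loadSet ξ) :
    ∃ x τ τ₀ ν, N.IsOptimal f ξ sl x ∧ (∀ y, N.IsOptimal f ξ sl y → y = x) ∧
      N.IsKKT f ξ sl x τ τ₀ ν ∧ nG - 1 ≤ {c | ν c ≠ 0}.ncard ∧
      N.bindingSet f ξ sl = {c | N.IsTight ξ x c} := by
  obtain ⟨⟨x, hx, huniq⟩, h⟩ := hf.2 ξ hξ sl hsl
  obtain ⟨τ, τ₀, ν, hk, hcard⟩ := h x hx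
  refine ⟨x, τ, τ₀, ν, hx, huniq, hk, hcard, Set.ext fun c => ⟨?_, fun hc => ⟨x, hx, hc⟩⟩⟩
  rintro ⟨y, hy, hc⟩
  rwa [huniq y hy] at hc

theorem le_ncard_bindingSet [NeZero nG] {N : PowerNetwork nG nL nE} {f : Fin nG → ℝ}
    (hf : f ∈ N.costSet) {ξ : Limit nG nE → ℝ} (hξ : ξ ∈ N.limitSet) {sl : Fin nL → ℝ}
    (hsl : sl ∈ N.loadSet ξ) : nG - 1 ≤ (N.bindingSet f ξ sl).ncard := by
  obtain ⟨x, τ, τ₀, ν, -, -, hk, hcard, hb⟩ := exists_kkt_of_mem_costSet hf hξ hsl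
  rw [hb]
  exact hcard.trans (Set.ncard_le_ncard (fun c hc => (hk.complementary c).resolve_left hc))

theorem opf_eq [NeZero nG] {N : PowerNetwork nG nL nE} {f : Fin nG → ℝ}
    {ξ : Limit nG nE → ℝ} {sl : Fin nL → ℝ} {x : (Fin nG → ℝ) × (Fin nG ⊕ Fin nL → ℝ)}
    (hx : N.IsOptimal f ξ sl x) (huniq : ∀ y, N.IsOptimal f ξ sl y → y = x) :
    N.opf f ξ sl = x.1 := by
  have h : ∃ x, N.IsOptimal f ξ sl x := ⟨x, hx⟩
  rw [opf, dif_pos h, huniq _ (Classical.choose_spec h)]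

theorem eventually_slack (N : PowerNetwork nG nL nE) {ξ : Limit nG nE → ℝ}
    {θ₀ : Fin nG ⊕ Fin nL → ℝ} (h : ∀ c, 0 ≤ limitSign c * (ξ c - N.limitQuantity c θ₀)) :
    ∀ᶠ θ in 𝓝 θ₀, ∀ c, N.limitQuantity c θ₀ ≠ ξ c →
      0 < limitSign c * (ξ c - N.limitQuantity c θ) := by
  refine eventually_all.2 fun c => ?_
  by_cases hc : N.limitQuantity c θ₀ = ξ c
  · exact Eventually.of_forall fun θ h' => (h' hc).elim
  · have hpos : 0 < limitSign c * (ξ c - N.limitQuantity c θ₀) :=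
      lt_of_le_of_ne (h c)
        (mul_ne_zero (limitSign_ne_zero c) (sub_ne_zero.2 (Ne.symm hc))).symm
    have hcont := (N.limitQuantity c).continuous_of_finiteDimensional
    have : ContinuousAt (fun θ => limitSign c * (ξ c - N.limitQuantity c θ)) θ₀ := by fun_prop
    exact (this.eventually_const_lt hpos).mono fun θ hθ _ => hθ

/-- A short step along a kernel direction keeps tight limits tight and slack limits slack, so the
same multipliers certify a second optimum, against uniqueness. -/
theorem systemMap_injective [NeZero nG] {N : PowerNetwork nG nL nE} {f : Fin nG → ℝ}
    {ξ : Limit nG nE → ℝ} {sl : Fin nL → ℝ} {x : (Fin nG → ℝ) × (Fin nG ⊕ Fin nL → ℝ)}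
    {τ : Fin nG ⊕ Fin nL → ℝ} {τ₀ : ℝ} {ν : Limit nG nE → ℝ}
    (hk : N.IsKKT f ξ sl x τ τ₀ ν) (huniq : ∀ y, N.IsOptimal f ξ sl y → y = x) :
    Function.Injective (N.systemMap {c | N.IsTight ξ x c}) := by
  rw [← LinearMap.ker_eq_bot, LinearMap.ker_eq_bot']
  intro d hd
  obtain ⟨hx1, hx0, hxs, hxc⟩ := (N.feasible_iff _ _ _).1 hk.feasible
  have hd0 : d (Sum.inl 0) = 0 := congrArg (fun p => p.1.1) hd
  have hds : N.served d = 0 := congrArg (fun p => p.1.2) hd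
  have hdc : ∀ c, N.IsTight ξ x c → N.limitQuantity c d = 0 := fun c hc =>
    congrFun (congrArg Prod.snd hd) ⟨c, hc⟩
  have hcont : ContinuousAt (fun t : ℝ => x.2 + t • d) 0 := by fun_prop
  have hev := hcont.eventually (p := fun θ => ∀ c, N.limitQuantity c x.2 ≠ ξ c →
      0 < limitSign c * (ξ c - N.limitQuantity c θ)) (by simpa using N.eventually_slack hxc)
  obtain ⟨t, ht, ht0⟩ := ((hev.filter_mono nhdsWithin_le_nhds).and
    (self_mem_nhdsWithin (s := {(0 : ℝ)}ᶜ))).exists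
  have htight : ∀ c, N.IsTight ξ x c → N.limitQuantity c (x.2 + t • d) = ξ c := fun c hc => by
    rw [map_add, map_smul, hdc c hc, (N.isTight_iff ξ hx1 c).1 hc]; simp
  have hfeas : N.Feasible ξ sl (N.generated (x.2 + t • d), x.2 + t • d) := by
    refine (N.feasible_iff _ _ _).2 ⟨rfl, by simp [hx0, hd0], by simp [hxs, hds], fun c => ?_⟩
    by_cases hc : N.IsTight ξ x c
    · simp only [htight c hc]; simp
    · exact (ht c fun h => hc ((N.isTight_iff ξ hx1 c).2 h)).le
  have hopt := (hk.of_feasible hfeas fun c hc => (N.isTight_iff ξ rfl c).2 (htight c hc)).isOptimal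
  have := congrArg Prod.snd (huniq _ hopt)
  have h2 : t • d = 0 := by simpa using this
  exact (smul_eq_zero.1 h2).resolve_left ht0

theorem regular_load_stable [NeZero nG] {N : PowerNetwork nG nL nE}
    {f : Fin nG → ℝ} (hf : f ∈ N.costSet) {ξ : Limit nG nE → ℝ} (hξ : ξ ∈ N.limitSet)
    {sl : Fin nL → ℝ} (hsl : sl ∈ N.regularLoadSet f ξ) :
    DifferentiableAt ℝ (N.opf f ξ) sl ∧ ∃ U ∈ 𝓝 sl, U ⊆ N.loadSet ξ ∧
      ∀ s ∈ U, N.bindingSet f ξ s = N.bindingSet f ξ sl := by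
  obtain ⟨hload, hcard⟩ := hsl
  obtain ⟨x, τ, τ₀, ν, hx, huniq, hk, -, hb⟩ := exists_kkt_of_mem_costSet hf hξ hload
  rw [hb] at hcard ⊢
  obtain ⟨hx1, hx0, hxs, hxc⟩ := (N.feasible_iff _ _ _).1 hx.1
  set T : Set (Limit nG nE) := {c | N.IsTight ξ x c} with hTdef
  have hT : ∀ c, c ∈ T ↔ N.limitQuantity c x.2 = ξ c := N.isTight_iff ξ hx1
  -- The system is square: `1 + nL + (nG - 1) = nG + nL`, where the truncated subtraction is
  -- harmless because `nG > 0`.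
  have hfr : Module.finrank ℝ (Fin nG ⊕ Fin nL → ℝ)
      = Module.finrank ℝ ((ℝ × (Fin nL → ℝ)) × (T → ℝ)) := by
    rw [finrank_systemMap_codomain, Module.finrank_fintype_fun_eq_card, Fintype.card_sum,
      Fintype.card_fin, Fintype.card_fin, hcard]
    have := NeZero.pos nG
    omega
  let M := LinearEquiv.ofInjectiveOfFinrankEq (N.systemMap T) (systemMap_injective hk huniq) hfr
  have hM : ∀ p, N.systemMap T (M.symm p) = p := fun p => M.apply_symm_apply p
  have hMx : M x.2 = (((0 : ℝ), sl), fun c : T => ξ c) :=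
    Prod.ext (Prod.ext hx0 hxs) (funext fun c => (hT c).1 c.2)
  -- The candidate optimal angles at load `s`: the limits in `T` are kept in force and the linear
  -- system is solved.
  let θ : (Fin nL → ℝ) → (Fin nG ⊕ Fin nL → ℝ) := fun s => M.symm ((0, s), fun c => ξ c)
  have hθsl : θ sl = x.2 := by
    change M.symm _ = _
    rw [← hMx, M.symm_apply_apply]
  have hθd : Differentiable ℝ θ := by
    have : Fintype T := Fintype.ofFinite T
    have h1 : Differentiable ℝ (M.symm : (ℝ × (Fin nL → ℝ)) × (T → ℝ) → _) :=
      (LinearMap.toContinuousLinearMap M.symm.toLinearMap).differentiable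
    exact h1.comp (f := fun s => (((0 : ℝ), s), fun c : T => ξ c)) (by fun_prop)
  have hev : ∀ᶠ s in 𝓝 sl, ∀ c, N.limitQuantity c x.2 ≠ ξ c →
      0 < limitSign c * (ξ c - N.limitQuantity c (θ s)) :=
    hθd.continuous.continuousAt.eventually (by rw [hθsl]; exact N.eventually_slack hxc)
  have hpos : ∀ᶠ s in 𝓝 sl, ∀ j, 0 < s j :=
    eventually_all.2 fun j => (continuous_apply j).continuousAt.eventually_const_lt (hload.1 j)
  have hθT : ∀ s, ∀ c ∈ T, N.limitQuantity c (θ s) = ξ c := fun s c hc =>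
    congrFun (congrArg Prod.snd (hM ((0, s), fun c => ξ c))) ⟨c, hc⟩
  have hmain : ∀ᶠ s in 𝓝 sl, s ∈ N.loadSet ξ ∧ N.bindingSet f ξ s = T ∧
      N.opf f ξ s = N.generated (θ s) := by
    filter_upwards [hev, hpos] with s hs hspos
    have hfeas : N.Feasible ξ s (N.generated (θ s), θ s) := by
      refine (N.feasible_iff _ _ _).2 ⟨rfl, congrArg (fun p => p.1.1) (hM ((0, s), fun c => ξ c)),
        congrArg (fun p => p.1.2) (hM ((0, s), fun c => ξ c)), fun c => ?_⟩
      by_cases hc : c ∈ T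
      · simp only [hθT s c hc]; simp
      · exact (hs c fun h => hc ((hT c).2 h)).le
    have hs_load : s ∈ N.loadSet ξ := ⟨hspos, _, hfeas⟩
    have hopt := (hk.of_feasible hfeas fun c hc =>
      (N.isTight_iff ξ rfl c).2 (hθT s c hc)).isOptimal
    obtain ⟨y, -, -, -, hy, hyu, -, -, hyb⟩ := exists_kkt_of_mem_costSet hf hξ hs_load
    obtain rfl := hyu _ hopt
    refine ⟨hs_load, ?_, opf_eq hy hyu⟩
    rw [hyb]
    ext c
    refine (N.isTight_iff ξ rfl c).trans ⟨fun h => ?_, hθT s c⟩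
    by_contra hc
    have := hs c fun h => hc ((hT c).2 h)
    simp only [h] at this
    simp at this
  refine ⟨?_, _, hmain, fun s hs => hs.1, fun s hs => hs.2.1⟩
  have hgd : Differentiable ℝ N.generated :=
    (LinearMap.toContinuousLinearMap N.generated).differentiable
  exact ((hgd.comp hθd) sl).congr_of_eventuallyEq (hmain.mono fun s hs => hs.2.2)

end PowerNetwork

/-! ### Assembly: generic limits, then generic loads. -/

open PowerNetwork in
theorem theorem1 {nG nL nE : ℕ} [NeZero nG] [NeZero nL] (N : PowerNetwork nG nL nE)
    (f : Fin nG → ℝ) (hf : f ∈ N.costSet) :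
    ∃ Ξ : Set (Limit nG nE → ℝ), Ξ ⊆ N.limitSet ∧ N.limitSet ⊆ closure Ξ ∧
      ∀ ξ ∈ Ξ,
        closure (interior (N.loadSet ξ)) = closure (N.loadSet ξ) ∧
        N.loadSet ξ ⊆ closure (N.regularLoadSet f ξ) ∧
        ∀ sl ∈ N.regularLoadSet f ξ,
          DifferentiableAt ℝ (N.opf f ξ) sl ∧
          ∃ U ∈ 𝓝 sl, U ⊆ N.loadSet ξ ∧
            ∀ s ∈ U, N.bindingSet f ξ s = N.bindingSet f ξ sl := by

  -- Without admissible limits there is no optimum to yield `AnglesDetermined`, but the claim is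
  -- then vacuous.
  rcases N.limitSet.eq_empty_or_nonempty with he | ⟨ξ₀, hξ₀⟩
  · exact ⟨∅, Set.empty_subset _, by simp [he], by simp⟩
  obtain ⟨sl₀, hsl₀⟩ : ∃ sl, sl ∈ N.loadSet ξ₀ := hξ₀.2
  have hN : N.AnglesDetermined :=
    anglesDetermined_of_existsUnique (hf.2 ξ₀ hξ₀ sl₀ hsl₀).1
  choose u w huw hrel using fun T : {T : Set (Limit nG nE) // nG ≤ T.ncard} =>
    hN.exists_relation T.2
  -- Limits violating every relation in which the loads do not appear.
  let D : Set (Limit nG nE → ℝ) :=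
    ⋂ T : {T : {T : Set (Limit nG nE) // nG ≤ T.ncard} // u T = 0}, {ξ | w T ξ + 0 ≠ 0}
  have hD : Dense D := by
    have : Fintype (Limit nG nE) := Fintype.ofFinite _
    exact dense_iInter_of_finite fun T => isOpen_dense_affine_ne_zero (huw T T.2) 0
  refine ⟨interior N.limitSet ∩ D, fun ξ hξ => interior_subset hξ.1, ?_, ?_⟩
  · calc N.limitSet ⊆ closure N.limitSet := subset_closure
      _ = closure (interior N.limitSet) :=
        (N.convex_limitSet.closure_interior_eq_closure_of_nonempty_interior
          hN.interior_limitSet_nonempty).symm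
      _ ⊆ closure (interior N.limitSet ∩ D) :=
        closure_minimal (hD.open_subset_closure_inter isOpen_interior) isClosed_closure
  rintro ξ ⟨hξi, hξD⟩
  have hξ : ξ ∈ N.limitSet := interior_subset hξi
  have hcl : closure (interior (N.loadSet ξ)) = closure (N.loadSet ξ) :=
    (N.convex_loadSet ξ).closure_interior_eq_closure_of_nonempty_interior
      (hN.interior_loadSet_nonempty hξi)
  refine ⟨hcl, ?_, fun sl hsl => regular_load_stable hf hξ hsl⟩
  -- For the fixed `ξ`, loads violating every relation in which they do appear.
  let G : Set (Fin nL → ℝ) :=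
    ⋂ T : {T : {T : Set (Limit nG nE) // nG ≤ T.ncard} // u T ≠ 0}, {sl | u T sl + w T ξ ≠ 0}
  have hG : Dense G := dense_iInter_of_finite fun T => isOpen_dense_affine_ne_zero T.2 _
  calc N.loadSet ξ ⊆ closure (N.loadSet ξ) := subset_closure
    _ = closure (interior (N.loadSet ξ)) := hcl.symm
    _ ⊆ closure (interior (N.loadSet ξ) ∩ G) :=
      closure_minimal (hG.open_subset_closure_inter isOpen_interior) isClosed_closure
    _ ⊆ closure (N.regularLoadSet f ξ) := closure_mono ?_
  rintro sl ⟨hsli, hslG⟩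
  have hsl : sl ∈ N.loadSet ξ := interior_subset hsli
  refine ⟨hsl, le_antisymm ?_ (le_ncard_bindingSet hf hξ hsl)⟩
  -- More than `nG - 1` binding limits would satisfy the relation of their set, which `D` or `G`
  -- excludes.
  by_contra! hlt
  obtain ⟨x, -, -, -, hx, -, -, -, hb⟩ := exists_kkt_of_mem_costSet hf hξ hsl
  obtain ⟨hx1, hx0, hxs, -⟩ := (N.feasible_iff _ _ _).1 hx.1
  let T : {T : Set (Limit nG nE) // nG ≤ T.ncard} := ⟨N.bindingSet f ξ sl, by omega⟩
  have h := hrel T x.2 ξ hx0 fun c hc => (N.isTight_iff ξ hx1 c).1 (by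
    have : c ∈ N.bindingSet f ξ sl := hc
    rwa [hb] at this)
  rw [hxs] at h
  by_cases hu : u T = 0
  · refine Set.mem_iInter.1 hξD ⟨T, hu⟩ ?_
    simpa [hu] using h
  · exact Set.mem_iInter.1 hslG ⟨T, hu⟩ h
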